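/- Let $\Omega,A\subset\mathbb{R}$ be compact intervals, let $p$ be a Borel probability measure on $\Omega$ (the common prior), and let $U,V:\Omega\times A\to\mathbb{R}$ be the utilities of a receiver and of a sender, where $U(\omega,a)$, $V(\omega,a)$ depend on the state $\omega$ and the receiver's action $a$. Assume that for every $\omega\in\Omega$ the function $U(\omega,\cdot)$ is twice differentiable and strictly concave on $A$ with $U_{aa}(\omega,\cdot)<0$, and $U_a(\omega,a)=0$ for some $a\in A$; that $V(\omega,\cdot)$ is differentiable on $A$ for every $\omega\in\Omega$; that $U_a(\cdot,a)$ and $V_a(\cdot,a)$ are continuous on $\Omega$ for every $a\in A$; that $V_a$ is bounded on $\Omega\times A$; and that $U(\cdot,a)$ and $V(\cdot,a)$ are $p$-integrable for every $a\in A$. (Derivatives at the end points of $A$ are one-sided.) An information structure is a measurable space $M$ of messages together with a Markov kernel from states to messages, to which the sender commits before learning the state. After a message $m$ the receiver takes the action in $A$ that maximizes his expected utility $\mathbb{E}(U(\omega,a)\mid m)$ under the posterior belief given $m$, and the sender's payoff is the resulting expectation of $V$. Full disclosure is the information structure in which the message is the state. An information structure is suboptimal if some other information structure gives the sender a strictly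 larger payoff. Suppose that there are two states $\omega_1,\omega_2$ in the support of $p$ such that $$\frac{V_a(\omega_1,a_1)}{-U_{aa}(\omega_1,a_1)}>\frac{V_a(\omega_2,a_2)}{-U_{aa}(\omega_2,a_2)}$$ for all $a_1,a_2\in A$ with $a_1<a_2$ and $U_a(\omega_1,a_1)<0<U_a(\omega_2,a_2)$, and that at least one such pair $(a_1,a_2)$ exists. Then full disclosure is suboptimal for the sender. -/

import Mathlib

open MeasureTheory ProbabilityTheory Set

noncomputable section

/-- The data of a sender-receiver environment. States and actions are real numbers in the compact
intervals `[stateLo, stateHi]` and `[actLo, actHi]`; `U` and `V` are the utilities of the receiver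
and of the sender (first argument: the state, second argument: the action), and `prior` is the
common prior over states. -/
structure Environment where
  stateLo : ℝ
  stateHi : ℝ
  actLo : ℝ
  actHi : ℝ
  U : ℝ → ℝ → ℝ
  V : ℝ → ℝ → ℝ
  prior : Measure ℝ
  isProb : IsProbabilityMeasure prior
  prior_states : prior (Icc stateLo stateHi)ᶜ = 0

attribute [instance] Environment.isProb

namespace Environment

/-- The set of states. -/
def Ω (E : Environment) : Set ℝ := Icc E.stateLo E.stateHi

/-- The set of actions. -/
def A (E : Environment) : Set ℝ := Icc E.actLo E.actHi

/-- The partial derivative `U_a` (one-sided at the end points of `A`). -/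
def Ua (E : Environment) (ω a : ℝ) : ℝ := derivWithin (E.U ω) E.A a

/-- The second partial derivative `U_aa` (one-sided at the end points of `A`). -/
def Uaa (E : Environment) (ω a : ℝ) : ℝ := derivWithin (E.Ua ω) E.A a

/-- The partial derivative `V_a` (one-sided at the end points of `A`). -/
def Va (E : Environment) (ω a : ℝ) : ℝ := derivWithin (E.V ω) E.A a

/-- The standing assumptions on the two utility functions. -/
structure Regular (E : Environment) : Prop where
  /-- `U` is twice differentiable in the action, -/
  U_diff : ∀ ω ∈ E.Ω, DifferentiableOn ℝ (E.U ω) E.A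
  Ua_diff : ∀ ω ∈ E.Ω, DifferentiableOn ℝ (E.Ua ω) E.A
  /-- strictly concave in the action, with negative second derivative, -/
  U_concave : ∀ ω ∈ E.Ω, StrictConcaveOn ℝ E.A (E.U ω)
  Uaa_neg : ∀ ω ∈ E.Ω, ∀ a ∈ E.A, E.Uaa ω a < 0
  /-- with a zero of `U_a` in every state, -/
  Ua_zero : ∀ ω ∈ E.Ω, ∃ a ∈ E.A, E.Ua ω a = 0
  /-- and `U_a` is continuous in the state. -/
  Ua_cont : ∀ a ∈ E.A, ContinuousOn (fun ω => E.Ua ω a) E.Ω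
  /-- `V` is differentiable in the action, -/
  V_diff : ∀ ω ∈ E.Ω, DifferentiableOn ℝ (E.V ω) E.A
  /-- and `V_a` is continuous in the state and bounded. -/
  Va_cont : ∀ a ∈ E.A, ContinuousOn (fun ω => E.Va ω a) E.Ω
  Va_bdd : ∃ K : ℝ, ∀ ω ∈ E.Ω, ∀ a ∈ E.A, |E.Va ω a| ≤ K
  /-- Each action has a well-defined finite ex ante expected utility for both parties. -/
  U_int : ∀ a ∈ E.A, Integrable (fun ω => E.U ω a) E.prior
  V_int : ∀ a ∈ E.A, Integrable (fun ω => E.V ω a) E.prior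

end Environment

/-- An information structure: a message space together with a measurable assignment of a
distribution over messages to every state. -/
structure InfoStructure where
  Msg : Type
  [measMsg : MeasurableSpace Msg]
  kernel : Kernel ℝ Msg
  [markov : IsMarkovKernel kernel]

attribute [instance] InfoStructure.measMsg InfoStructure.markov

/-- Full disclosure: the message is the state. -/
def fullDisclosure : InfoStructure where
  Msg := ℝ
  kernel := Kernel.id

namespace Environment

/-- `α` is an optimal strategy of the receiver under the information structure `I`: after almost
every message `m` (for the distribution of messages induced by the prior) the action `α m`
maximizes his expected utility under the posterior belief given `m`. -/
def IsBestResponse (E : Environment) (I : InfoStructure) (α : I.Msg → ℝ) : Prop :=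
  Measurable α ∧ (∀ m, α m ∈ E.A) ∧
    ∀ᵐ m ∂(E.prior.bind I.kernel),
      IsMaxOn (fun a => ∫ ω, E.U ω a ∂(posterior I.kernel E.prior m)) E.A (α m)

/-- `v` is the expected utility of the sender under the information structure `I`, when the
receiver reacts optimally. The pair (state, message) is distributed as
`E.prior.compProd I.kernel`. -/
def IsSenderPayoff (E : Environment) (I : InfoStructure) (v : ℝ) : Prop :=
  ∃ α : I.Msg → ℝ, E.IsBestResponse I α ∧
    Integrable (fun q : ℝ × I.Msg => E.V q.1 (α q.2)) (E.prior.compProd I.kernel) ∧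
    v = ∫ q, E.V q.1 (α q.2) ∂(E.prior.compProd I.kernel)

/-- `I` is suboptimal for the sender: some other information structure gives her a strictly
larger expected utility. -/
def IsSuboptimal (E : Environment) (I : InfoStructure) : Prop :=
  ∃ v : ℝ, E.IsSenderPayoff I v ∧
    ∃ (I' : InfoStructure) (v' : ℝ), E.IsSenderPayoff I' v' ∧ v < v'

/-- The pairs of actions to which the non-transparency condition for `ω₁, ω₂` applies. -/
def Opposed (E : Environment) (ω₁ ω₂ a₁ a₂ : ℝ) : Prop :=
  a₁ ∈ E.A ∧ a₂ ∈ E.A ∧ a₁ < a₂ ∧ E.Ua ω₁ a₁ < 0 ∧ 0 < E.Ua ω₂ a₂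

/-- The non-transparency condition for the pair of states `ω₁, ω₂`. -/
def NonTransparent (E : Environment) (ω₁ ω₂ : ℝ) : Prop :=
  ∀ a₁ a₂ : ℝ, E.Opposed ω₁ ω₂ a₁ a₂ →
    E.Va ω₁ a₁ / (-E.Uaa ω₁ a₁) > E.Va ω₂ a₂ / (-E.Uaa ω₂ a₂)

end Environment

end

/-! Take an action `x` strictly between the bliss points of `ω₁` and `ω₂`. Pooling the two states
with odds `U_a(ω₂, x) : -U_a(ω₁, x)` makes `x` optimal for the receiver. By Cauchy's mean value
theorem the sender's gain `V(ωᵢ, x) - V(ωᵢ, blissᵢ)` is `-U_a(ωᵢ, x)` times a ratio `V_a / (-U_aa)`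
at some `cᵢ`, with `c₁ < x < c₂`; the condition compares exactly these ratios, so the pool gains
(`pooling_gain_pos`).

Single states may have prior mass zero, so small neighbourhoods are pooled instead. The gain is
continuous in the state (`continuousOn_V_sub_bliss`) and every neighbourhood of a support point has
positive mass, so the strict inequality survives. All states stay disclosed except for the weight
sent to the pool; `isSuboptimal_of_pooling` compares the payoffs. -/

open Filter Topology

namespace Environment

variable {E : Environment}

theorem isClosed_Ω : IsClosed E.Ω := isClosed_Icc

theorem measurableSet_Ω : MeasurableSet E.Ω := measurableSet_Icc

theorem convex_A : Convex ℝ E.A := convex_Icc _ _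

theorem ae_mem_Ω : ∀ᵐ ω ∂E.prior, ω ∈ E.Ω := E.prior_states

theorem support_prior_subset : E.prior.support ⊆ E.Ω :=
  Measure.support_subset_of_isClosed isClosed_Ω ae_mem_Ω

/-- A function that is continuous in the state is integrable for the prior. -/
theorem integrable_of_continuousOn {f : ℝ → ℝ} (hf : ContinuousOn f E.Ω) :
    Integrable f E.prior := by
  have h : IntegrableOn f E.Ω E.prior := hf.integrableOn_compact isCompact_Icc
  rwa [IntegrableOn, Measure.restrict_eq_self_of_ae_mem ae_mem_Ω] at h

/-! ### The receiver's bliss point as a function of the state. -/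

namespace Regular

variable (hE : E.Regular)
include hE

theorem nonempty_A : E.A.Nonempty := by
  obtain ⟨ω, hω⟩ := (ae_mem_Ω (E := E)).exists
  obtain ⟨a, ha, -⟩ := hE.Ua_zero ω hω
  exact ⟨a, ha⟩

theorem strictAntiOn_Ua {ω : ℝ} (hω : ω ∈ E.Ω) : StrictAntiOn (E.Ua ω) E.A :=
  (hE.U_concave ω hω).strictAntiOn_derivWithin (hE.U_diff ω hω)

/-- A concave utility lies below its tangents. -/
theorem U_le_tangent {ω a x : ℝ} (hω : ω ∈ E.Ω) (ha : a ∈ E.A) (hx : x ∈ E.A) :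
    E.U ω a ≤ E.U ω x + E.Ua ω x * (a - x) := by
  have hc := (hE.U_concave ω hω).concaveOn
  have hd := hE.U_diff ω hω x hx
  rcases lt_trichotomy a x with h | rfl | h
  · have := hc.derivWithin_le_slope ha hx h hd
    rw [slope_def_field, le_div_iff₀ (sub_pos.2 h)] at this
    change E.Ua ω x * (x - a) ≤ _ at this
    linarith
  · simp
  · have := hc.slope_le_derivWithin hx ha h hd
    rw [slope_def_field, div_le_iff₀ (sub_pos.2 h)] at this
    change _ ≤ E.Ua ω x * (a - x) at this
    linarith

theorem hasDerivAt_V {ω t : ℝ} (hω : ω ∈ E.Ω) (ht : t ∈ Ioo E.actLo E.actHi) :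
    HasDerivAt (E.V ω) (E.Va ω t) t :=
  (hE.V_diff ω hω t (Ioo_subset_Icc_self ht)).hasDerivWithinAt.hasDerivAt
    (Icc_mem_nhds ht.1 ht.2)

theorem hasDerivAt_Ua {ω t : ℝ} (hω : ω ∈ E.Ω) (ht : t ∈ Ioo E.actLo E.actHi) :
    HasDerivAt (E.Ua ω) (E.Uaa ω t) t :=
  (hE.Ua_diff ω hω t (Ioo_subset_Icc_self ht)).hasDerivWithinAt.hasDerivAt
    (Icc_mem_nhds ht.1 ht.2)

theorem exists_V_lipschitz : ∃ K : ℝ, ∀ ω ∈ E.Ω, ∀ a ∈ E.A, ∀ b ∈ E.A,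
    |E.V ω a - E.V ω b| ≤ K * |a - b| := by
  obtain ⟨K, hK⟩ := hE.Va_bdd
  exact ⟨K, fun ω hω a ha b hb => Convex.norm_image_sub_le_of_norm_derivWithin_le
    (hE.V_diff ω hω) (hK ω hω) convex_A hb ha⟩

/-- The fixed value off `E.Ω` makes `bliss` Borel on the whole line. -/
theorem exists_Ua_eq_zero (ω : ℝ) :
    ∃ a ∈ E.A, (ω ∈ E.Ω → E.Ua ω a = 0) ∧ (ω ∉ E.Ω → a = E.actLo) := by
  by_cases hω : ω ∈ E.Ω
  · obtain ⟨a, ha, h0⟩ := hE.Ua_zero ω hω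
    exact ⟨a, ha, fun _ => h0, fun h => (h hω).elim⟩
  · obtain ⟨a, ha⟩ := hE.nonempty_A
    exact ⟨E.actLo, left_mem_Icc.2 (ha.1.trans ha.2), fun h => (hω h).elim, fun _ => rfl⟩

/-- The optimal action of a receiver who knows the state. -/
noncomputable def bliss (ω : ℝ) : ℝ := (hE.exists_Ua_eq_zero ω).choose

theorem bliss_mem (ω : ℝ) : hE.bliss ω ∈ E.A := (hE.exists_Ua_eq_zero ω).choose_spec.1

theorem Ua_bliss {ω : ℝ} (hω : ω ∈ E.Ω) : E.Ua ω (hE.bliss ω) = 0 :=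
  (hE.exists_Ua_eq_zero ω).choose_spec.2.1 hω

theorem bliss_of_notMem {ω : ℝ} (hω : ω ∉ E.Ω) : hE.bliss ω = E.actLo :=
  (hE.exists_Ua_eq_zero ω).choose_spec.2.2 hω

theorem lt_bliss_iff {ω a : ℝ} (hω : ω ∈ E.Ω) (ha : a ∈ E.A) :
    a < hE.bliss ω ↔ 0 < E.Ua ω a := by
  rw [← hE.Ua_bliss hω]
  exact ((hE.strictAntiOn_Ua hω).lt_iff_gt (hE.bliss_mem ω) ha).symm

theorem bliss_lt_iff {ω a : ℝ} (hω : ω ∈ E.Ω) (ha : a ∈ E.A) :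
    hE.bliss ω < a ↔ E.Ua ω a < 0 := by
  rw [← hE.Ua_bliss hω]
  exact ((hE.strictAntiOn_Ua hω).lt_iff_gt ha (hE.bliss_mem ω)).symm

theorem isMaxOn_bliss {ω : ℝ} (hω : ω ∈ E.Ω) : IsMaxOn (E.U ω) E.A (hE.bliss ω) := by
  intro a ha
  simpa [hE.Ua_bliss hω] using hE.U_le_tangent hω ha (hE.bliss_mem ω)

/-- For `c` in `E.A`, being below or above the bliss point is a strict sign condition on `U_a(ω,
c)`, hence open in `ω`. Joint continuity of `U_a` is not needed. -/
theorem continuousOn_bliss : ContinuousOn hE.bliss E.Ω := by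
  intro ω hω
  refine tendsto_order.2 ⟨fun c hc => ?_, fun c hc => ?_⟩
  · by_cases hcA : c ∈ E.A
    · filter_upwards [(hE.Ua_cont c hcA ω hω).eventually
        (lt_mem_nhds ((hE.lt_bliss_iff hω hcA).1 hc)), self_mem_nhdsWithin] with ω' h h'
      exact (hE.lt_bliss_iff h' hcA).2 h
    · have : c < E.actLo := by
        by_contra! h
        exact hcA ⟨h, hc.le.trans (hE.bliss_mem ω).2⟩
      exact Eventually.of_forall fun ω' => this.trans_le (hE.bliss_mem ω').1
  · by_cases hcA : c ∈ E.A
    · filter_upwards [(hE.Ua_cont c hcA ω hω).eventually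
        (gt_mem_nhds ((hE.bliss_lt_iff hω hcA).1 hc)), self_mem_nhdsWithin] with ω' h h'
      exact (hE.bliss_lt_iff h' hcA).2 h
    · have : E.actHi < c := by
        by_contra! h
        exact hcA ⟨(hE.bliss_mem ω).1.trans hc.le, h⟩
      exact Eventually.of_forall fun ω' => (hE.bliss_mem ω').2.trans_lt this

theorem measurable_bliss : Measurable hE.bliss := by
  classical
  have h : hE.bliss = E.Ω.piecewise hE.bliss fun _ => E.actLo := by
    ext ω
    by_cases hω : ω ∈ E.Ω
    · simp [hω]
    · simp [hω, hE.bliss_of_notMem hω]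
  rw [h]
  exact hE.continuousOn_bliss.measurable_piecewise continuousOn_const measurableSet_Ω

/-! ### Integrability and continuity of the sender's utility. -/

/-- The sender's utility is integrable along any measurable choice of actions. -/
theorem integrable_V {X : Type*} [MeasurableSpace X] {μ : Measure X} {f g : X → ℝ}
    (hf : MeasurePreserving f μ E.prior) (hg : Measurable g) (hgA : ∀ x, g x ∈ E.A) :
    Integrable (fun x => E.V (f x) (g x)) μ := by
  have : IsFiniteMeasure μ := ⟨by
    rw [← preimage_univ (f := f), hf.measure_preimage nullMeasurableSet_univ]
    exact measure_lt_top _ _⟩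
  obtain ⟨a₀, ha₀⟩ := hE.nonempty_A
  obtain ⟨K, hK⟩ := hE.exists_V_lipschitz
  have hΩ : ∀ᵐ x ∂μ, f x ∈ E.Ω := hf.quasiMeasurePreserving.ae ae_mem_Ω
  have hVc : ∀ a ∈ E.A, Integrable (fun x => E.V (f x) a) μ := fun a ha =>
    hf.integrable_comp_of_integrable (hE.V_int a ha)
  -- Carathéodory argument: `V` is measurable in the state at each fixed action and continuous in
  -- the action, so `g` is approximated by simple functions.
  have hmeas : AEStronglyMeasurable (fun x => E.V (f x) (g x)) μ := by
    let s := SimpleFunc.approxOn g hg E.A a₀ ha₀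
    have hs : ∀ n x, s n x ∈ E.A := SimpleFunc.approxOn_mem hg ha₀
    refine aestronglyMeasurable_of_tendsto_ae atTop (f := fun n x => E.V (f x) (s n x)) ?_ ?_
    · intro n
      have heq : (fun x => E.V (f x) (s n x)) = fun x =>
          ∑ c ∈ (s n).range, (s n ⁻¹' {c}).indicator (fun x => E.V (f x) c) x := by
        ext x
        rw [Finset.sum_eq_single (s n x)]
        · simp
        · intro c _ hc
          exact indicator_of_notMem (fun h => hc h.symm) _
        · exact fun h => (h (SimpleFunc.mem_range_self _ _)).elim
      rw [heq]
      refine Finset.aestronglyMeasurable_fun_sum _ fun c hc => ?_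
      obtain ⟨x, rfl⟩ := SimpleFunc.mem_range.1 hc
      exact (hVc _ (hs n x)).aestronglyMeasurable.indicator ((s n).measurableSet_fiber _)
    · filter_upwards [hΩ] with x hx
      exact ((hE.V_diff _ hx).continuousOn (g x) (hgA x)).tendsto.comp
        (tendsto_nhdsWithin_iff.2 ⟨SimpleFunc.tendsto_approxOn hg ha₀ (subset_closure (hgA x)),
          Eventually.of_forall fun n => hs n x⟩)
  have hdiff : Integrable (fun x => E.V (f x) (g x) - E.V (f x) a₀) μ := by
    refine Integrable.of_bound (hmeas.sub (hVc a₀ ha₀).aestronglyMeasurable)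
      (|K| * (E.actHi - E.actLo)) ?_
    filter_upwards [hΩ] with x hx
    refine (hK _ hx _ (hgA x) _ ha₀).trans (mul_le_mul (le_abs_self K) ?_ (abs_nonneg _)
      (abs_nonneg _))
    have h1 := hgA x
    rw [abs_le]
    constructor <;> linarith [h1.1, h1.2, ha₀.1, ha₀.2]
  exact (hdiff.add (hVc a₀ ha₀)).congr (Eventually.of_forall fun x => sub_add_cancel _ _)

theorem integrable_V_bliss : Integrable (fun ω => E.V ω (hE.bliss ω)) E.prior :=
  hE.integrable_V (MeasurePreserving.id _) hE.measurable_bliss hE.bliss_mem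

/-- Increments of the sender's utility in the action are continuous in the state. -/
theorem continuousOn_V_sub_of_le {a b : ℝ} (ha : a ∈ E.A) (hb : b ∈ E.A) (hab : a ≤ b) :
    ContinuousOn (fun ω => E.V ω b - E.V ω a) E.Ω := by
  obtain ⟨K, hK⟩ := hE.Va_bdd
  have hsub : Ioo a b ⊆ Ioo E.actLo E.actHi := Ioo_subset_Ioo ha.1 hb.2
  have hsubA : Icc a b ⊆ E.A := Icc_subset_Icc ha.1 hb.2
  have hmeas : ∀ ω ∈ E.Ω, AEStronglyMeasurable (E.Va ω) (volume.restrict (uIoc a b)) := by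
    intro ω hω
    -- On the open interval `V_a` is a genuine derivative, and derivatives are measurable.
    rw [uIoc_of_le hab, ← restrict_Ioo_eq_restrict_Ioc]
    refine (stronglyMeasurable_deriv (E.V ω)).aestronglyMeasurable.congr ?_
    filter_upwards [ae_restrict_mem measurableSet_Ioo] with t ht
    exact (hE.hasDerivAt_V hω (hsub ht)).deriv
  have hbd : ∀ ω ∈ E.Ω, ∀ t ∈ uIoc a b, ‖E.Va ω t‖ ≤ K := by
    intro ω hω t ht
    rw [uIoc_of_le hab] at ht
    exact hK ω hω t (hsubA (Ioc_subset_Icc_self ht))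
  have hcont : ContinuousOn (fun ω => ∫ t in a..b, E.Va ω t) E.Ω := by
    intro ω hω
    refine intervalIntegral.continuousWithinAt_of_dominated_interval (bound := fun _ => K)
      ?_ ?_ intervalIntegrable_const (Eventually.of_forall fun t ht => ?_)
    · filter_upwards [self_mem_nhdsWithin] with ω' h using hmeas ω' h
    · filter_upwards [self_mem_nhdsWithin] with ω' h
      exact Eventually.of_forall (hbd ω' h)
    · rw [uIoc_of_le hab] at ht
      exact hE.Va_cont t (hsubA (Ioc_subset_Icc_self ht)) ω hω
  refine hcont.congr fun ω hω => ?_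
  refine (intervalIntegral.integral_eq_sub_of_hasDerivAt_of_le hab
    ((hE.V_diff ω hω).continuousOn.mono hsubA)
    (fun t ht => hE.hasDerivAt_V hω (hsub ht)) ?_).symm
  rw [intervalIntegrable_iff]
  have : IsFiniteMeasure (volume.restrict (uIoc a b)) := ⟨by simp [uIoc_of_le hab]⟩
  refine Integrable.of_bound (hmeas ω hω) K ?_
  filter_upwards [ae_restrict_mem measurableSet_uIoc] with t ht using hbd ω hω t ht

theorem continuousOn_V_sub {a b : ℝ} (ha : a ∈ E.A) (hb : b ∈ E.A) :
    ContinuousOn (fun ω => E.V ω b - E.V ω a) E.Ω := by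
  rcases le_total a b with h | h
  · exact hE.continuousOn_V_sub_of_le ha hb h
  · exact (hE.continuousOn_V_sub_of_le hb ha h).neg.congr fun ω _ => (neg_sub _ _).symm

/-- The sender's gain from moving the action from the bliss point to `x` is continuous in the
state. -/
theorem continuousOn_V_sub_bliss {x : ℝ} (hx : x ∈ E.A) :
    ContinuousOn (fun ω => E.V ω x - E.V ω (hE.bliss ω)) E.Ω := by
  obtain ⟨K, hK⟩ := hE.exists_V_lipschitz
  intro ω hω
  -- Freeze the bliss point at `ω`; the Lipschitz bound in the action controls the error.
  have h1 := hE.continuousOn_V_sub (hE.bliss_mem ω) hx ω hω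
  have h2 : Tendsto (fun ω' => E.V ω' (hE.bliss ω) - E.V ω' (hE.bliss ω')) (𝓝[E.Ω] ω) (𝓝 0) := by
    refine squeeze_zero_norm' (a := fun ω' => K * |hE.bliss ω - hE.bliss ω'|) ?_ ?_
    · filter_upwards [self_mem_nhdsWithin] with ω' h
      exact hK ω' h _ (hE.bliss_mem ω) _ (hE.bliss_mem ω')
    · have h3 : Tendsto hE.bliss (𝓝[E.Ω] ω) (𝓝 (hE.bliss ω)) := hE.continuousOn_bliss ω hω
      simpa using ((tendsto_const_nhds (x := hE.bliss ω)).sub h3).abs.const_mul K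
  simpa [ContinuousWithinAt] using h1.tendsto.add h2

/-- Under the non-transparency condition, pooling two states in the proportions that induce an
action `x` between their bliss points benefits the sender. -/
theorem pooling_gain_pos {ω₁ ω₂ x : ℝ} (h₁ : ω₁ ∈ E.Ω) (h₂ : ω₂ ∈ E.Ω)
    (hnt : E.NonTransparent ω₁ ω₂) (hx₁ : hE.bliss ω₁ < x) (hx₂ : x < hE.bliss ω₂) :
    0 < E.Ua ω₂ x * (E.V ω₁ x - E.V ω₁ (hE.bliss ω₁))
      - E.Ua ω₁ x * (E.V ω₂ x - E.V ω₂ (hE.bliss ω₂)) := by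
  have hb₁ := hE.bliss_mem ω₁
  have hb₂ := hE.bliss_mem ω₂
  have hx : x ∈ E.A := ⟨hb₁.1.trans hx₁.le, hx₂.le.trans hb₂.2⟩
  have cauchy : ∀ ω ∈ E.Ω, ∀ a ∈ E.A, ∀ b ∈ E.A, a < b → ∃ c ∈ Ioo a b,
      (E.Ua ω b - E.Ua ω a) * E.Va ω c = (E.V ω b - E.V ω a) * E.Uaa ω c := by
    intro ω hω a ha b hb hab
    have hI : Ioo a b ⊆ Ioo E.actLo E.actHi := Ioo_subset_Ioo ha.1 hb.2
    have hA : Icc a b ⊆ E.A := Icc_subset_Icc ha.1 hb.2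
    exact exists_ratio_hasDerivAt_eq_ratio_slope (E.V ω) (E.Va ω) hab
      ((hE.V_diff ω hω).continuousOn.mono hA) (fun t ht => hE.hasDerivAt_V hω (hI ht))
      (E.Ua ω) (E.Uaa ω) ((hE.Ua_diff ω hω).continuousOn.mono hA)
      (fun t ht => hE.hasDerivAt_Ua hω (hI ht))
  obtain ⟨c₁, hc₁, e₁⟩ := cauchy ω₁ h₁ _ hb₁ x hx hx₁
  obtain ⟨c₂, hc₂, e₂⟩ := cauchy ω₂ h₂ x hx _ hb₂ hx₂
  rw [hE.Ua_bliss h₁] at e₁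
  rw [hE.Ua_bliss h₂] at e₂
  have hA₁ : c₁ ∈ E.A := ⟨hb₁.1.trans hc₁.1.le, hc₁.2.le.trans hx.2⟩
  have hA₂ : c₂ ∈ E.A := ⟨hx.1.trans hc₂.1.le, hc₂.2.le.trans hb₂.2⟩
  have hr := hnt c₁ c₂ ⟨hA₁, hA₂, hc₁.2.trans hc₂.1, (hE.bliss_lt_iff h₁ hA₁).1 hc₁.1,
    (hE.lt_bliss_iff h₂ hA₂).1 hc₂.2⟩
  have n₁ := hE.Uaa_neg ω₁ h₁ c₁ hA₁
  have n₂ := hE.Uaa_neg ω₂ h₂ c₂ hA₂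
  have d₁ : E.V ω₁ x - E.V ω₁ (hE.bliss ω₁)
      = -E.Ua ω₁ x * (E.Va ω₁ c₁ / (-E.Uaa ω₁ c₁)) := by
    field_simp [n₁.ne]
    linarith
  have d₂ : E.V ω₂ x - E.V ω₂ (hE.bliss ω₂)
      = -E.Ua ω₂ x * (E.Va ω₂ c₂ / (-E.Uaa ω₂ c₂)) := by
    field_simp [n₂.ne]
    linarith
  -- The gain is now `-U_a(ω₁, x) * U_a(ω₂, x)` times the difference of the two ratios.
  rw [d₁, d₂]
  have hp := mul_pos (mul_pos (neg_pos.2 ((hE.bliss_lt_iff h₁ hx).1 hx₁))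
    ((hE.lt_bliss_iff h₂ hx).1 hx₂)) (sub_pos.2 hr)
  linarith

end Regular

end Environment

/-! ### The pooling kernel and its posterior beliefs. -/

instance Sum.instMeasurableSingletonClass {α β : Type*} [MeasurableSpace α] [MeasurableSpace β]
    [MeasurableSingletonClass α] [MeasurableSingletonClass β] :
    MeasurableSingletonClass (α ⊕ β) := by
  refine ⟨?_⟩
  rintro (a | b)
  · rw [← image_singleton]
    exact (measurableSet_singleton a).inl_image
  · rw [← image_singleton]
    exact (measurableSet_singleton b).inr_image

/-- The kernel that, in state `ω`, sends the message `inr ()` with probability `w ω` and otherwise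
reveals the state. -/
noncomputable def poolingKernel (w : ℝ → ℝ) (hw : Measurable w) : Kernel ℝ (ℝ ⊕ Unit) where
  toFun ω := ENNReal.ofReal (1 - w ω) • Measure.dirac (Sum.inl ω)
    + ENNReal.ofReal (w ω) • Measure.dirac (Sum.inr ())
  measurable' := by
    refine Measure.measurable_of_measurable_coe _ fun s hs => ?_
    have hind : Measurable fun ω : ℝ => s.indicator (1 : ℝ ⊕ Unit → ENNReal) (Sum.inl ω) :=
      (measurable_one.indicator hs).comp measurable_inl
    simp only [Measure.add_apply, Measure.smul_apply, Measure.dirac_apply' _ hs, smul_eq_mul]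
    fun_prop

section Pooling

variable {w : ℝ → ℝ} (hw : Measurable w)

theorem poolingKernel_apply (ω : ℝ) : poolingKernel w hw ω
    = ENNReal.ofReal (1 - w ω) • Measure.dirac (Sum.inl ω)
      + ENNReal.ofReal (w ω) • Measure.dirac (Sum.inr ()) := rfl

theorem isMarkovKernel_poolingKernel (h0 : ∀ ω, 0 ≤ w ω) (h1 : ∀ ω, w ω ≤ 1) :
    IsMarkovKernel (poolingKernel w hw) := by
  refine ⟨fun ω => ⟨?_⟩⟩
  simp [poolingKernel_apply, ← ENNReal.ofReal_add (sub_nonneg.2 (h1 ω)) (h0 ω)]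

theorem lintegral_poolingKernel {f : ℝ ⊕ Unit → ENNReal} (hf : Measurable f) (ω : ℝ) :
    ∫⁻ m, f m ∂poolingKernel w hw ω
      = ENNReal.ofReal (1 - w ω) * f (Sum.inl ω) + ENNReal.ofReal (w ω) * f (Sum.inr ()) := by
  rw [poolingKernel_apply, lintegral_add_measure, lintegral_smul_measure, lintegral_smul_measure,
    lintegral_dirac' _ hf, lintegral_dirac' _ hf, smul_eq_mul, smul_eq_mul]

theorem integral_poolingKernel (h0 : ∀ ω, 0 ≤ w ω) (h1 : ∀ ω, w ω ≤ 1) (f : ℝ ⊕ Unit → ℝ)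
    (ω : ℝ) : ∫ m, f m ∂poolingKernel w hw ω
      = (1 - w ω) * f (Sum.inl ω) + w ω * f (Sum.inr ()) := by
  rw [poolingKernel_apply, integral_add_measure, integral_smul_measure, integral_smul_measure,
    integral_dirac, integral_dirac, ENNReal.toReal_ofReal (sub_nonneg.2 (h1 ω)),
    ENNReal.toReal_ofReal (h0 ω), smul_eq_mul, smul_eq_mul]
  · exact (integrable_dirac (by simp)).smul_measure ENNReal.ofReal_ne_top
  · exact (integrable_dirac (by simp)).smul_measure ENNReal.ofReal_ne_top

/-- The belief after the pooling message: the prior reweighted by `w`. -/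
noncomputable def pooledBelief (p : Measure ℝ) (w : ℝ → ℝ) : Measure ℝ :=
  (∫⁻ ω, ENNReal.ofReal (w ω) ∂p)⁻¹ • p.withDensity fun ω => ENNReal.ofReal (w ω)

/-- The posterior beliefs induced by `poolingKernel`. -/
noncomputable def pooledPosterior (p : Measure ℝ) (w : ℝ → ℝ) : Kernel (ℝ ⊕ Unit) ℝ where
  toFun := Sum.elim Measure.dirac fun _ => pooledBelief p w
  measurable' := Measure.measurable_dirac.sumElim measurable_const

theorem integral_pooledBelief (p : Measure ℝ) (hw : Measurable w) (h0 : ∀ ω, 0 ≤ w ω) (f : ℝ → ℝ) :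
    ∫ ω, f ω ∂pooledBelief p w
      = ((∫⁻ ω, ENNReal.ofReal (w ω) ∂p)⁻¹).toReal * ∫ ω, w ω * f ω ∂p := by
  rw [pooledBelief, integral_smul_measure,
    integral_withDensity_eq_integral_toReal_smul hw.ennreal_ofReal (by simp), smul_eq_mul]
  simp [ENNReal.toReal_ofReal (h0 _)]

variable {p : Measure ℝ} [IsProbabilityMeasure p]

theorem lintegral_weight_ne_top (h1 : ∀ ω, w ω ≤ 1) : ∫⁻ ω, ENNReal.ofReal (w ω) ∂p ≠ ⊤ := by
  refine ((lintegral_mono (g := fun _ => 1) fun ω => ?_).trans_lt (by simp)).ne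
  simpa using h1 ω

theorem isMarkovKernel_pooledPosterior (h1 : ∀ ω, w ω ≤ 1)
    (hpos : ∫⁻ ω, ENNReal.ofReal (w ω) ∂p ≠ 0) : IsMarkovKernel (pooledPosterior p w) := by
  refine ⟨fun m => ⟨?_⟩⟩
  rcases m with ω | _
  · exact measure_univ (μ := Measure.dirac ω)
  · change pooledBelief p w univ = 1
    rw [pooledBelief, Measure.smul_apply, withDensity_apply _ MeasurableSet.univ,
      Measure.restrict_univ, smul_eq_mul, ENNReal.inv_mul_cancel hpos (lintegral_weight_ne_top h1)]

/-- A posterior is determined almost everywhere by the joint law. Against test functions both joint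
laws agree: the probability of the pooling message cancels the normalisation of the belief. -/
theorem pooledPosterior_ae_eq (h1 : ∀ ω, w ω ≤ 1)
    [IsMarkovKernel (poolingKernel w hw)] (hpos : ∫⁻ ω, ENNReal.ofReal (w ω) ∂p ≠ 0) :
    ∀ᵐ m ∂(p.bind (poolingKernel w hw)),
      pooledPosterior p w m = posterior (poolingKernel w hw) p m := by
  have := isMarkovKernel_pooledPosterior h1 hpos
  have hne := lintegral_weight_ne_top (p := p) h1
  have hw' : Measurable fun ω => ENNReal.ofReal (w ω) := hw.ennreal_ofReal
  refine ae_eq_posterior_of_compProd_eq (Measure.ext_of_lintegral _ fun f hf => ?_)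
  have hin : Measurable fun m => ∫⁻ ω, f (m, ω) ∂pooledPosterior p w m :=
    hf.lintegral_kernel_prod_right'
  have hl : ∀ ω, ∫⁻ ω', f (Sum.inl ω, ω') ∂pooledPosterior p w (Sum.inl ω) = f (Sum.inl ω, ω) :=
    fun ω => lintegral_dirac' ω (hf.comp measurable_prodMk_left)
  have hfr : Measurable fun ω => f (Sum.inr (), ω) := hf.comp measurable_prodMk_left
  have hfl : Measurable fun ω => ENNReal.ofReal (1 - w ω) * f (Sum.inl ω, ω) := by
    have : Measurable fun ω : ℝ => f (Sum.inl ω, ω) :=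
      hf.comp (measurable_inl.prodMk measurable_id)
    fun_prop
  have hr : ∫⁻ ω, f (Sum.inr (), ω) ∂pooledPosterior p w (Sum.inr ())
      = (∫⁻ ω, ENNReal.ofReal (w ω) ∂p)⁻¹ * ∫⁻ ω, ENNReal.ofReal (w ω) * f (Sum.inr (), ω) ∂p := by
    change ∫⁻ ω, f (Sum.inr (), ω) ∂pooledBelief p w = _
    rw [pooledBelief, lintegral_smul_measure, lintegral_withDensity_eq_lintegral_mul _ hw' hfr,
      smul_eq_mul]
    rfl
  rw [Measure.lintegral_compProd hf, Measure.lintegral_bind (Kernel.aemeasurable _)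
    hin.aemeasurable, lintegral_map hf measurable_swap,
    Measure.lintegral_compProd (f := fun q => f q.swap) (hf.comp measurable_swap)]
  simp_rw [lintegral_poolingKernel hw hin, hl, hr]
  have hRHS : ∀ ω, ∫⁻ m, f (Prod.swap (ω, m)) ∂poolingKernel w hw ω
      = ENNReal.ofReal (1 - w ω) * f (Sum.inl ω, ω)
        + ENNReal.ofReal (w ω) * f (Sum.inr (), ω) := fun ω =>
    lintegral_poolingKernel hw (f := fun m => f (m, ω)) (hf.comp measurable_prodMk_right) ω
  simp_rw [hRHS]
  rw [lintegral_add_left hfl, lintegral_add_left hfl, lintegral_mul_const _ hw', ← mul_assoc,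
    ENNReal.mul_inv_cancel hpos hne, one_mul]

end Pooling

/-! ### Payoffs under full disclosure and under pooling. -/

namespace Environment

variable {E : Environment}

namespace Regular

variable (hE : E.Regular)
include hE

theorem isSenderPayoff_fullDisclosure :
    E.IsSenderPayoff fullDisclosure (∫ ω, E.V ω (hE.bliss ω) ∂E.prior) := by
  have hdiag : Measurable (Function.diag : ℝ → ℝ × ℝ) := measurable_id.prodMk measurable_id
  have hmp : MeasurePreserving Prod.fst (E.prior.compProd (Kernel.id : Kernel ℝ ℝ)) E.prior :=
    ⟨measurable_fst, Measure.fst_compProd _ _⟩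
  have hint := hE.integrable_V (g := fun q : ℝ × ℝ => hE.bliss q.2) hmp
    (hE.measurable_bliss.comp measurable_snd) fun q => hE.bliss_mem q.2
  refine ⟨hE.bliss, ⟨hE.measurable_bliss, hE.bliss_mem, ?_⟩, hint, ?_⟩
  · change ∀ᵐ m ∂(E.prior.bind (Kernel.id : Kernel ℝ ℝ)), IsMaxOn
      (fun a => ∫ ω, E.U ω a ∂(posterior (Kernel.id : Kernel ℝ ℝ) E.prior m)) E.A (hE.bliss m)
    rw [Measure.id_comp]
    filter_upwards [posterior_id E.prior, ae_mem_Ω] with ω hω hΩ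
    simpa [hω, Kernel.id_apply] using! hE.isMaxOn_bliss hΩ
  · change _ = ∫ q, E.V q.1 (hE.bliss q.2) ∂(E.prior.compProd (Kernel.id : Kernel ℝ ℝ))
    rw [Measure.integral_compProd hint]
    simp [Kernel.id_apply]

/-- Weighted pooling of states induces `x` as soon as the weighted first-order condition holds
at `x`. -/
theorem isMaxOn_integral_mul_U {w : ℝ → ℝ} (hw : Measurable w) (h0 : ∀ ω, 0 ≤ w ω)
    (h1 : ∀ ω, w ω ≤ 1) {x : ℝ} (hx : x ∈ E.A) (hfoc : ∫ ω, w ω * E.Ua ω x ∂E.prior = 0) :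
    IsMaxOn (fun a => ∫ ω, w ω * E.U ω a ∂E.prior) E.A x := by
  have hint : ∀ {f : ℝ → ℝ}, Integrable f E.prior →
      Integrable (fun ω => w ω * f ω) E.prior := fun hf =>
    hf.bdd_mul hw.aestronglyMeasurable (c := 1)
      (Eventually.of_forall fun ω => by simpa [abs_of_nonneg (h0 ω)] using h1 ω)
  intro a ha
  have hU := hint (hE.U_int x hx)
  have hUa := (hint (integrable_of_continuousOn (hE.Ua_cont x hx))).mul_const (a - x)
  calc ∫ ω, w ω * E.U ω a ∂E.prior
      ≤ ∫ ω, (w ω * E.U ω x + w ω * E.Ua ω x * (a - x)) ∂E.prior := by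
        refine integral_mono_ae (hint (hE.U_int a ha)) (hU.add hUa) ?_
        filter_upwards [ae_mem_Ω] with ω hω
        have := mul_le_mul_of_nonneg_left (hE.U_le_tangent hω ha hx) (h0 ω)
        linarith
    _ = ∫ ω, w ω * E.U ω x ∂E.prior := by
        rw [integral_add hU hUa, integral_mul_const, hfoc, zero_mul, add_zero]

/-- If pooling states with weights `w` induces an action `x` that the sender prefers on average,
then full disclosure is suboptimal. -/
theorem isSuboptimal_of_pooling {w : ℝ → ℝ} (hw : Measurable w) (h0 : ∀ ω, 0 ≤ w ω)
    (h1 : ∀ ω, w ω ≤ 1) {x : ℝ} (hx : x ∈ E.A) (hfoc : ∫ ω, w ω * E.Ua ω x ∂E.prior = 0)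
    (hgain : 0 < ∫ ω, w ω * (E.V ω x - E.V ω (hE.bliss ω)) ∂E.prior) :
    E.IsSuboptimal fullDisclosure := by
  have hM := isMarkovKernel_poolingKernel hw h0 h1
  -- A pool of probability zero would yield no gain.
  have hpos : ∫⁻ ω, ENNReal.ofReal (w ω) ∂E.prior ≠ 0 := by
    intro h
    rw [lintegral_eq_zero_iff hw.ennreal_ofReal] at h
    have hz : ∫ ω, w ω * (E.V ω x - E.V ω (hE.bliss ω)) ∂E.prior = 0 := by
      refine integral_eq_zero_of_ae ?_
      filter_upwards [h] with ω hω
      simp [le_antisymm (ENNReal.ofReal_eq_zero.1 hω) (h0 ω)]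
    exact hgain.ne' hz
  let α : ℝ ⊕ Unit → ℝ := Sum.elim hE.bliss fun _ => x
  have hα : Measurable α := hE.measurable_bliss.sumElim measurable_const
  have hαA : ∀ m, α m ∈ E.A := by
    rintro (ω | _)
    · exact hE.bliss_mem ω
    · exact hx
  have hmp : MeasurePreserving Prod.fst (E.prior.compProd (poolingKernel w hw)) E.prior :=
    ⟨measurable_fst, Measure.fst_compProd _ _⟩
  have hint := hE.integrable_V (g := fun q : ℝ × (ℝ ⊕ Unit) => α q.2) hmp
    (hα.comp measurable_snd) fun q => hαA q.2
  -- The bliss point is known to be optimal only for states in `E.Ω`; other revealed states are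
  -- null.
  have hmem : ∀ᵐ m ∂(E.prior.bind (poolingKernel w hw)), ∀ ω, m = Sum.inl ω → ω ∈ E.Ω := by
    have hS : MeasurableSet {m : ℝ ⊕ Unit | ∀ ω, m = Sum.inl ω → ω ∈ E.Ω} := by
      refine measurableSet_sum_iff.2 ⟨?_, ?_⟩
      · simpa using measurableSet_Ω
      · simp
    rw [Measure.ae_comp_iff hS]
    filter_upwards [ae_mem_Ω] with ω hω
    rw [poolingKernel_apply, ae_add_measure_iff]
    refine ⟨Measure.ae_smul_measure ?_ _, Measure.ae_smul_measure ?_ _⟩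
    · rw [ae_dirac_iff hS]
      rintro ω' h
      exact Sum.inl_injective h ▸ hω
    · rw [ae_dirac_iff hS]
      simp
  refine ⟨_, hE.isSenderPayoff_fullDisclosure, ⟨ℝ ⊕ Unit, poolingKernel w hw⟩, _,
    ⟨α, ⟨hα, hαA, ?_⟩, hint, rfl⟩, ?_⟩
  · filter_upwards [pooledPosterior_ae_eq hw h1 hpos, hmem] with m hm hmΩ
    rw [← hm]
    rcases m with ω | _
    · have : ∀ a, ∫ ω', E.U ω' a ∂(pooledPosterior E.prior w (Sum.inl ω)) = E.U ω a :=
        fun a => integral_dirac (fun ω' => E.U ω' a) ω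
      simp only [this]
      exact hE.isMaxOn_bliss (hmΩ ω rfl)
    · have : ∀ a, ∫ ω', E.U ω' a ∂(pooledPosterior E.prior w (Sum.inr ())) = _ :=
        fun a => integral_pooledBelief E.prior hw h0 fun ω => E.U ω a
      simp only [this]
      intro a ha
      exact mul_le_mul_of_nonneg_left (hE.isMaxOn_integral_mul_U hw h0 h1 hx hfoc ha)
        ENNReal.toReal_nonneg
  · have hb := hE.integrable_V_bliss
    have hD : Integrable (fun ω => w ω * (E.V ω x - E.V ω (hE.bliss ω))) E.prior :=
      ((hE.V_int x hx).sub hb).bdd_mul hw.aestronglyMeasurable (c := 1)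
        (Eventually.of_forall fun ω => by simpa [abs_of_nonneg (h0 ω)] using h1 ω)
    have : ∫ q, E.V q.1 (α q.2) ∂(E.prior.compProd (poolingKernel w hw))
        = ∫ ω, E.V ω (hE.bliss ω) ∂E.prior
          + ∫ ω, w ω * (E.V ω x - E.V ω (hE.bliss ω)) ∂E.prior := by
      rw [Measure.integral_compProd hint, ← integral_add hb hD]
      refine integral_congr_ae (Eventually.of_forall fun ω => ?_)
      simp only [integral_poolingKernel hw h0 h1 (fun m => E.V ω (α m)), α, Sum.elim_inl,
        Sum.elim_inr]
      ring
    change _ < ∫ q, E.V q.1 (α q.2) ∂(E.prior.compProd (poolingKernel w hw))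
    rw [this]
    linarith

end Regular

end Environment

/-! ### Pooling neighbourhoods of the two states. -/

theorem mainTheorem2 (E : Environment) (hE : E.Regular) (ω₁ ω₂ : ℝ)
    (hω₁ : ω₁ ∈ E.prior.support) (hω₂ : ω₂ ∈ E.prior.support)
    (hnt : E.NonTransparent ω₁ ω₂)
    (hnonvac : ∃ a₁ a₂ : ℝ, E.Opposed ω₁ ω₂ a₁ a₂) :
    E.IsSuboptimal fullDisclosure := by
  have h₁ := E.support_prior_subset hω₁
  have h₂ := E.support_prior_subset hω₂
  obtain ⟨a₁, a₂, ha₁, ha₂, hlt, hn, hp⟩ := hnonvac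
  have hb₁ := (hE.bliss_lt_iff h₁ ha₁).2 hn
  have hb₂ := (hE.lt_bliss_iff h₂ ha₂).2 hp
  have hu₁ : E.Ua ω₁ a₁ < 0 := hn
  have hu₂ : 0 < E.Ua ω₂ a₁ := (hE.lt_bliss_iff h₂ ha₁).1 (hlt.trans hb₂)
  -- The action `a₁` lies strictly between the two bliss points and serves as the pooled action.
  have hgain := hE.pooling_gain_pos h₁ h₂ hnt hb₁ (hlt.trans hb₂)
  set u : ℝ → ℝ := fun ω => E.Ua ω a₁
  set D : ℝ → ℝ := fun ω => E.V ω a₁ - E.V ω (hE.bliss ω)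
  have huc : ContinuousOn u E.Ω := hE.Ua_cont a₁ ha₁
  have hDc : ContinuousOn D E.Ω := hE.continuousOn_V_sub_bliss ha₁
  have hui := Environment.integrable_of_continuousOn huc
  have hDi := Environment.integrable_of_continuousOn hDc
  have hev : ∀ᶠ q : ℝ × ℝ in 𝓝[E.Ω] ω₁ ×ˢ 𝓝[E.Ω] ω₂, 0 < u q.2 * D q.1 - u q.1 * D q.2 := by
    have t₁ : Tendsto u (𝓝[E.Ω] ω₁) (𝓝 (u ω₁)) := huc ω₁ h₁
    have t₂ : Tendsto u (𝓝[E.Ω] ω₂) (𝓝 (u ω₂)) := huc ω₂ h₂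
    have s₁ : Tendsto D (𝓝[E.Ω] ω₁) (𝓝 (D ω₁)) := hDc ω₁ h₁
    have s₂ : Tendsto D (𝓝[E.Ω] ω₂) (𝓝 (D ω₂)) := hDc ω₂ h₂
    exact (((t₂.comp tendsto_snd).mul (s₁.comp tendsto_fst)).sub
      ((t₁.comp tendsto_fst).mul (s₂.comp tendsto_snd))).eventually (lt_mem_nhds hgain)
  obtain ⟨P₁, hP₁, P₂, hP₂, hP⟩ := eventually_prod_iff.1 hev
  have nbhd : ∀ ω ∈ E.prior.support, ∀ Q : ℝ → Prop, (∀ᶠ ω' in 𝓝[E.Ω] ω, Q ω') →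
      ∃ N : Set ℝ, MeasurableSet N ∧ (∀ ω' ∈ N, Q ω') ∧ 0 < E.prior N := by
    intro ω hω Q hQ
    obtain ⟨O, hO, hωO, hOQ⟩ := mem_nhdsWithin.1 hQ
    refine ⟨O ∩ E.Ω, hO.measurableSet.inter Environment.measurableSet_Ω, fun ω' h => hOQ h, ?_⟩
    rw [measure_inter_conull (t := E.Ω) E.prior_states]
    exact (Measure.mem_support_iff_forall ω).1 hω O (hO.mem_nhds hωO)
  obtain ⟨N₁, mN₁, hN₁, pN₁⟩ := nbhd ω₁ hω₁ (fun ω => P₁ ω ∧ u ω < 0)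
    (hP₁.and ((huc ω₁ h₁).eventually (gt_mem_nhds hu₁)))
  obtain ⟨N₂, mN₂, hN₂, pN₂⟩ := nbhd ω₂ hω₂ (fun ω => P₂ ω ∧ 0 < u ω)
    (hP₂.and ((huc ω₂ h₂).eventually (lt_mem_nhds hu₂)))
  have hI₁ : ∫ ω in N₁, u ω ∂E.prior ≤ 0 :=
    setIntegral_nonpos mN₁ fun ω h => (hN₁ ω h).2.le
  have hI₂ : 0 ≤ ∫ ω in N₂, u ω ∂E.prior :=
    setIntegral_nonneg mN₂ fun ω h => (hN₂ ω h).2.le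
  set I₁ := ∫ ω in N₁, u ω ∂E.prior
  set I₂ := ∫ ω in N₂, u ω ∂E.prior
  -- The summand `1` keeps `c` positive and the weights at most `1`, even where `N₁` and `N₂` might
  -- overlap.
  let c : ℝ := 1 + I₂ - I₁
  have hc : 0 < c := by simp only [c]; linarith
  -- Crossed weights: the first-order condition at `a₁` reads `I₂ * I₁ - I₁ * I₂ = 0`.
  let w : ℝ → ℝ := fun ω => N₁.indicator (fun _ => I₂ / c) ω + N₂.indicator (fun _ => -I₁ / c) ω
  have hw : Measurable w :=
    (measurable_const.indicator mN₁).add (measurable_const.indicator mN₂)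
  have hw0 : ∀ ω, 0 ≤ w ω := fun ω => add_nonneg
    (indicator_nonneg (fun _ _ => div_nonneg hI₂ hc.le) _)
    (indicator_nonneg (fun _ _ => div_nonneg (neg_nonneg.2 hI₁) hc.le) _)
  have hw1 : ∀ ω, w ω ≤ 1 := by
    intro ω
    calc w ω ≤ I₂ / c + -I₁ / c := add_le_add
          (indicator_le_self' (fun _ _ => div_nonneg hI₂ hc.le) _)
          (indicator_le_self' (fun _ _ => div_nonneg (neg_nonneg.2 hI₁) hc.le) _)
      _ ≤ 1 := by
          rw [← add_div, div_le_one hc]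
          simp only [c]
          linarith
  have hwint : ∀ f : ℝ → ℝ, Integrable f E.prior → ∫ ω, w ω * f ω ∂E.prior
      = I₂ / c * ∫ ω in N₁, f ω ∂E.prior + -I₁ / c * ∫ ω in N₂, f ω ∂E.prior := by
    intro f hf
    have hsplit : (fun ω => w ω * f ω) = fun ω =>
        N₁.indicator (fun ω => I₂ / c * f ω) ω + N₂.indicator (fun ω => -I₁ / c * f ω) ω := by
      ext ω
      by_cases k₁ : ω ∈ N₁ <;> by_cases k₂ : ω ∈ N₂ <;> simp [w, k₁, k₂, add_mul]
    rw [hsplit, integral_add ((hf.const_mul _).indicator mN₁) ((hf.const_mul _).indicator mN₂),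
      integral_indicator mN₁, integral_indicator mN₂, integral_const_mul, integral_const_mul]
  refine hE.isSuboptimal_of_pooling hw hw0 hw1 ha₁ ?_ ?_
  · rw [hwint u hui]
    change I₂ / c * I₁ + -I₁ / c * I₂ = 0
    ring
  · change 0 < ∫ ω, w ω * D ω ∂E.prior
    rw [hwint D hDi]
    -- By Fubini, `c` times the gain is this double integral, whose integrand is the positive
    -- two-state gain.
    have hprod : 0 < ∫ q in N₁ ×ˢ N₂, (D q.1 * u q.2 - u q.1 * D q.2) ∂(E.prior.prod E.prior) := by
      have hi : Integrable (fun q : ℝ × ℝ => D q.1 * u q.2 - u q.1 * D q.2)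
          (E.prior.prod E.prior) := (hDi.mul_prod hui).sub (hui.mul_prod hDi)
      have hq : ∀ q ∈ N₁ ×ˢ N₂, 0 < D q.1 * u q.2 - u q.1 * D q.2 := fun q h => by
        have := hP (hN₁ _ h.1).1 (hN₂ _ h.2).1
        simp only at this
        linarith
      rw [setIntegral_pos_iff_support_of_nonneg_ae _ hi.integrableOn]
      · rw [inter_eq_self_of_subset_right (show N₁ ×ˢ N₂ ⊆ Function.support _ from
          fun q h => (hq q h).ne'), Measure.prod_prod]
        exact ENNReal.mul_pos pN₁.ne' pN₂.ne'
      · filter_upwards [ae_restrict_mem (mN₁.prod mN₂)] with q h using (hq q h).le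
    rw [integral_sub (hDi.mul_prod hui).integrableOn (hui.mul_prod hDi).integrableOn,
      setIntegral_prod_mul, setIntegral_prod_mul] at hprod
    refine (div_pos hprod hc).trans_eq ?_
    change ((∫ ω in N₁, D ω ∂E.prior) * I₂ - I₁ * ∫ ω in N₂, D ω ∂E.prior) / c = _
    ring
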